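/- Definitions. For $n \ge 0$ let $\mathcal{Q}_n$ be the set of Stirling permutations of order $n$: the rearrangements $\sigma$ of the multiset $\{1^2, 2^2, \ldots, n^2\}$ such that, for each $i$, every letter between the two occurrences of $i$ is greater than $i$. The block $[i,i]_\sigma$ is the string of consecutive letters of $\sigma$ from the first to the second occurrence of $i$, both included. A block has level $1$ if it is contained in no other block; for $\ell \ge 2$, a block $[i,i]_\sigma$ has level $\ell$ if it is properly contained in a block $[j,j]_\sigma$ of level $\ell - 1$ (its parent) and is a level $1$ block of the string strictly between the two occurrences of $j$. Two blocks are siblings if both have level $1$ or they have the same parent. Let $\mathrm{bl}^{(\ell)}(\sigma)$ be the number of blocks of level $\ell$ of $\sigma$. A pattern is a permutation $p \in \mathfrak{S}_m$, $m \ge 1$, some of whose consecutive entries may be connected by underlines; the empty pattern $\emptyset$ is also allowed, with the convention that it never occurs. An occurrence of $p$ in a permutation $\pi \in \mathfrak{S}_n$ is a choice of positions $i_1 < \cdots < i_m$ such that $\pi_{i_1} \cdots \pi_{i_m}$ is order isomorphic to $p$, and $i_{j+1} = i_j + 1$ whenever $p_j$ and $p_{j+1}$ are connected by an underline; $p(\pi)$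 is the number of occurrences. An occurrence of $p$ as a block pattern at level $\ell$ in $\sigma \in \mathcal{Q}_n$ is a choice of level $\ell$ blocks $[b_1,b_1]_\sigma, \ldots, [b_m,b_m]_\sigma$, appearing from left to right in $\sigma$ and all siblings, such that $b_1 \cdots b_m$ is order isomorphic to $p$, and such that the second occurrence of $b_j$ is immediately followed by the first occurrence of $b_{j+1}$ in $\sigma$ whenever $p_j$ and $p_{j+1}$ are connected by an underline; $p^{(\ell)}(\sigma)$ is the number of such occurrences. For a set $A$ of patterns, let $\mathfrak{S}_n(A)$ be the set of $\pi \in \mathfrak{S}_n$ with $a(\pi) = 0$ for all $a \in A$, and for a pattern $p$ put $$F^{A,p}(t,z) = 1 + \sum_{n \ge 1} \frac{t^n}{n!} \sum_{\pi \in \mathfrak{S}_n(A)} z^{p(\pi)}.$$ For a sequence $\mathbf{A} = (A_1, A_2, \ldots)$ of sets of patterns, let $\mathcal{Q}_n(\mathbf{A})$ be the set of $\sigma \in \mathcal{Q}_n$ with $a^{(i)}(\sigma) = 0$ for all $i \ge 1$ and $a \in A_i$. For a sequence $\mathbf{p} = (p_1, p_2, \ldots)$ of patterns and sequences $\mathbf{x}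 = (x_1, x_2, \ldots)$, $\mathbf{y} = (y_1, y_2, \ldots)$ of elements of a commutative $\mathbb{Q}$-algebra $R$ (for instance, of indeterminates), put $$G^{\mathbf{A},\mathbf{p}}(t;\mathbf{x};\mathbf{y}) = 1 + \sum_{n \ge 1} \frac{t^n}{n!} \sum_{\sigma \in \mathcal{Q}_n(\mathbf{A})} \prod_{i \ge 1} x_i^{p_i^{(i)}(\sigma)} y_i^{\mathrm{bl}^{(i)}(\sigma)},$$ a formal power series in $t$ over $R$. For a sequence $\mathbf{s} = (s_1, s_2, s_3, \ldots)$ let $\mathrm{sh}(\mathbf{s}) = (s_2, s_3, \ldots)$. Theorem 1. For all $\mathbf{A}$, $\mathbf{p}$, $\mathbf{x}$ and $\mathbf{y}$ as above, the following identity of formal power series in $t$ holds: $$G^{\mathbf{A},\mathbf{p}}(t;\mathbf{x};\mathbf{y}) = F^{A_1,p_1}\left( y_1 \int_0^t G^{\mathrm{sh}(\mathbf{A}),\mathrm{sh}(\mathbf{p})}(u;\mathrm{sh}(\mathbf{x});\mathrm{sh}(\mathbf{y}))\,\mathrm{d}u,\; x_1 \right).$$ -/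

import Mathlib

open PowerSeries

noncomputable section

namespace BlockPattern

/-! ### Permutation patterns -/

/-- A permutation pattern: a permutation of length `len`, some of whose consecutive entries are
connected by an underline. An index `j` lies in `underline` when the entries at the positions
`j` and `j + 1` (counted from `0`) are connected. The pattern with `len = 0` is the empty pattern
`∅`; by convention it never occurs. -/
structure Pattern where
  len : ℕ
  perm : Equiv.Perm (Fin len)
  underline : Finset (Fin (len - 1))

/-- The entries at positions `j` and `j + 1` of `p` exist and are connected by an underline. -/
def Pattern.Linked (p : Pattern) (j : ℕ) : Prop :=
  ∃ h : j < p.len - 1, (⟨j, h⟩ : Fin (p.len - 1)) ∈ p.underline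

/-- The word `b` is order isomorphic to the permutation underlying `p`. -/
def Pattern.OrderIso (p : Pattern) {α : Type*} [LT α] (b : Fin p.len → α) : Prop :=
  ∀ j k, b j < b k ↔ p.perm j < p.perm k

/-- The positions `i` form an occurrence of `p` in the word `w` of length `n`. -/
def Pattern.IsOccurrence (p : Pattern) {n : ℕ} {α : Type*} [LT α] (w : Fin n → α)
    (i : Fin p.len → Fin n) : Prop :=
  0 < p.len ∧ StrictMono i ∧ p.OrderIso (fun j => w (i j)) ∧
    ∀ j k : Fin p.len, (k : ℕ) = j + 1 → p.Linked j → (i k : ℕ) = i j + 1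

/-- The number `p(π)` of occurrences of `p` in the permutation `π`. -/
def Pattern.count (p : Pattern) {n : ℕ} (π : Equiv.Perm (Fin n)) : ℕ :=
  {i : Fin p.len → Fin n | p.IsOccurrence π i}.ncard

open Classical in
/-- The set `𝔖_n(A)` of permutations of length `n` that avoid all the patterns in `A`. -/
def permAvoid (A : Set Pattern) (n : ℕ) : Finset (Equiv.Perm (Fin n)) :=
  {π | ∀ a ∈ A, a.count π = 0}

/-! ### Stirling permutations and blocks -/

/-- The string `(i,i)_w` of letters of `w` strictly between the first two occurrences of `i`. -/
def inner (w : List ℕ) (i : ℕ) : List ℕ :=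
  ((w.dropWhile (· != i)).tail).takeWhile (· != i)

/-- The string `[i,i]_w` (for a letter `i` that occurs exactly twice in `w`). -/
def block (w : List ℕ) (i : ℕ) : List ℕ :=
  i :: (inner w i ++ [i])

/-- The set `𝒬_n` of Stirling permutations of order `n`: the rearrangements of the multiset
`{1^2, …, n^2}` in which every letter between the two occurrences of `i` is greater than `i`. -/
def stirling (n : ℕ) : Finset (List ℕ) :=
  {w ∈ (Multiset.lists (2 • (Finset.Icc 1 n).val)).toFinset |
    ∀ i ∈ Finset.Icc 1 n, ∀ x ∈ inner w i, i < x}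

/-- `[i,i]_w ⊂ [j,j]_w`. -/
def Sub (w : List ℕ) (i j : ℕ) : Prop :=
  i ≠ j ∧ block w i <:+: block w j

/-- `[i,i]_w` is a level `1` block of the word `w`. -/
def IsLevelOne (w : List ℕ) (i : ℕ) : Prop :=
  i ∈ w ∧ ¬ ∃ j ∈ w, Sub w i j

/-- `[i,i]_w` is a level `ℓ` block of `w` (levels start at `1`). Passing to reduced forms does not
affect being a level `1` block, so the words `(j,j)_w` are not reduced. -/
def IsLevel (w : List ℕ) : ℕ → ℕ → Prop
  | 0, _ => False
  | 1, i => IsLevelOne w i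
  | ℓ + 2, i => ∃ j, IsLevel w (ℓ + 1) j ∧ Sub w i j ∧ IsLevelOne (inner w j) i

/-- `[j,j]_w` is the parent of the block `[i,i]_w`. -/
def IsParent (w : List ℕ) (j i : ℕ) : Prop :=
  ∃ ℓ, IsLevel w ℓ j ∧ IsLevel w (ℓ + 1) i ∧ Sub w i j

/-- The blocks `[i,i]_w` and `[j,j]_w` are siblings. -/
def Siblings (w : List ℕ) (i j : ℕ) : Prop :=
  (IsLevel w 1 i ∧ IsLevel w 1 j) ∨ ∃ k, IsParent w k i ∧ IsParent w k j

/-- The number `bl^{(ℓ)}(w)` of level `ℓ` blocks of `w`. -/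
def bl (ℓ : ℕ) (w : List ℕ) : ℕ :=
  {i : ℕ | IsLevel w ℓ i}.ncard

/-- The position in `w` of the first occurrence of `i`. -/
def firstPos (w : List ℕ) (i : ℕ) : ℕ :=
  w.idxOf i

/-- The position in `w` of the second occurrence of `i`. -/
def secondPos (w : List ℕ) (i : ℕ) : ℕ :=
  w.idxOf i + (inner w i).length + 1

/-- The blocks `[b_1,b_1]_w, …, [b_m,b_m]_w` form an occurrence of `p` as a block pattern in `w`
at level `ℓ`. -/
def Pattern.IsBlockOccurrence (p : Pattern) (ℓ : ℕ) (w : List ℕ) (b : Fin p.len → ℕ) : Prop :=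
  0 < p.len ∧ (∀ j, IsLevel w ℓ (b j)) ∧ StrictMono (fun j => firstPos w (b j)) ∧
    (∀ j k, Siblings w (b j) (b k)) ∧ p.OrderIso b ∧
    ∀ j k : Fin p.len, (k : ℕ) = j + 1 → p.Linked j → firstPos w (b k) = secondPos w (b j) + 1

/-- The number `p^{(ℓ)}(w)` of occurrences of `p` as a block pattern in `w` at level `ℓ`. -/
def Pattern.blockCount (p : Pattern) (ℓ : ℕ) (w : List ℕ) : ℕ :=
  {b : Fin p.len → ℕ | p.IsBlockOccurrence ℓ w b}.ncard

/-! ### Generating functions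

A sequence `(s_1, s_2, …)` is a function `s` on `ℕ` with `s i` the entry `s_{i+1}`. -/

/-- The shifted sequence `sh(s) = (s_2, s_3, …)`. -/
def sh {α : Type*} (s : ℕ → α) : ℕ → α :=
  fun i => s (i + 1)

open Classical in
/-- The set `𝒬_n(A)` of Stirling permutations that avoid all the patterns in `A_i` at level `i`,
for all `i ≥ 1`. -/
def stirlingAvoid (A : ℕ → Set Pattern) (n : ℕ) : Finset (List ℕ) :=
  {w ∈ stirling n | ∀ i, ∀ a ∈ A i, a.blockCount (i + 1) w = 0}

variable {R : Type*} [CommRing R] [Algebra ℚ R]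

/-- The exponential generating function `1 + ∑_{n ≥ 1} c_n t^n / n!`. -/
def egf (c : ℕ → R) : R⟦X⟧ :=
  PowerSeries.mk fun n => if n = 0 then 1 else algebraMap ℚ R (1 / (n.factorial : ℚ)) * c n

/-- The polynomial `f_n^{A,p}(z) = ∑ z^{p(π)}`, over `π ∈ 𝔖_n(A)`. -/
def f (A : Set Pattern) (p : Pattern) (n : ℕ) (z : R) : R :=
  ∑ π ∈ permAvoid A n, z ^ p.count π

/-- `F^{A,p}(t, z)`, as a formal power series in `t`. -/
def F (A : Set Pattern) (p : Pattern) (z : R) : R⟦X⟧ :=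
  egf fun n => f A p n z

/-- The polynomial `g_n^{A,p}(x; y)`. The product has only finitely many factors other than `1`, as
a Stirling permutation has blocks at finitely many levels only. -/
def g (A : ℕ → Set Pattern) (p : ℕ → Pattern) (n : ℕ) (x y : ℕ → R) : R :=
  ∑ w ∈ stirlingAvoid A n,
    ∏ᶠ i : ℕ, x i ^ (p i).blockCount (i + 1) w * y i ^ bl (i + 1) w

/-- `G^{A,p}(t; x; y)`, as a formal power series in `t`. -/
def G (A : ℕ → Set Pattern) (p : ℕ → Pattern) (x y : ℕ → R) : R⟦X⟧ :=
  egf fun n => g A p n x y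

/-- The formal integral `∫_0^t c(u) du`. -/
def integral (c : R⟦X⟧) : R⟦X⟧ :=
  PowerSeries.mk fun n => if n = 0 then 0 else algebraMap ℚ R (1 / (n : ℚ)) * coeff (n - 1) c

/-- Multiples of a formal integral can be substituted into a power series. -/
theorem hasSubst_C_mul_integral (a : R) (c : R⟦X⟧) :
    PowerSeries.HasSubst (PowerSeries.C a * integral c : R⟦X⟧) := by
  apply PowerSeries.HasSubst.of_constantCoeff_zero'
  simp [integral, ← PowerSeries.coeff_zero_eq_constantCoeff_apply]

end BlockPattern

end


noncomputable section

namespace BlockPattern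

/-!
A Stirling word `w = b₁ l₁ b₁ b₂ l₂ b₂ ⋯ b_m l_m b_m` is the concatenation of its level `1` blocks.
Level `1` patterns of `w` depend only on the word `b₁ ⋯ b_m`, whereas the patterns and blocks of
level `i + 1` in `w` are those of level `i` in the words `l_j`. Each `b_j` is the least letter of
its block, so, once the letters of `w` are distributed among the blocks, the blocks may be put in
any order and `b₁ ⋯ b_m` runs through all orderings of the same set. Summing the first kind of
factor over these orderings gives the coefficients of `F`, and the second kind contributes the
`m`-th power of `y_1 ∫ G`, the integral accounting for the letter `b_j`. Since the words `l_j` need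
not have letters `1, …, n`, Stirling words are considered over arbitrary finite sets of letters,
and that a weighted sum over them depends only on the number of letters comes out of the induction.
-/

/-! ### Stirling words -/

/-- A Stirling word: every letter occurs exactly twice, with only greater letters in between. Its
letters may be any natural numbers, so that the two pieces left by removing the first level `1`
block are Stirling words as well. -/
structure IsStirling (w : List ℕ) : Prop where
  count_eq : ∀ i ∈ w, w.count i = 2
  lt_of_mem_inner : ∀ i ∈ w, ∀ x ∈ inner w i, i < x

/-- The word `b l b r`: for a Stirling word, `b l b` is its first level `1` block. -/
abbrev blockCons (b : ℕ) (l r : List ℕ) : List ℕ :=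
  b :: (l ++ b :: r)

theorem exists_eq_append_of_two_le_count {i : ℕ} {w : List ℕ} (h : 2 ≤ w.count i) :
    ∃ u v z, w = u ++ i :: (v ++ i :: z) ∧ i ∉ u ∧ i ∉ v := by
  obtain ⟨u, z, rfl, hu⟩ :=
    List.eq_append_cons_of_mem (List.count_pos_iff.1 (by omega : 0 < w.count i))
  have hz : 0 < z.count i := by
    simp only [List.count_append, List.count_eq_zero_of_not_mem hu, List.count_cons_self] at h
    omega
  obtain ⟨v, z, rfl, hv⟩ := List.eq_append_cons_of_mem (List.count_pos_iff.1 hz)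
  exact ⟨u, v, z, rfl, hu, hv⟩

theorem inner_append_cons {u v z : List ℕ} {i : ℕ} (hu : i ∉ u) (hv : i ∉ v) :
    inner (u ++ i :: (v ++ i :: z)) i = v := by
  have bne_of_notMem {l : List ℕ} (hl : i ∉ l) : ∀ a ∈ l, (a != i) = true := fun a ha =>
    bne_iff_ne.2 (ne_of_mem_of_not_mem ha hl)
  rw [inner, List.dropWhile_append_of_pos (bne_of_notMem hu),
    List.dropWhile_cons_of_neg (by simp), List.tail_cons,
    List.takeWhile_append_of_pos (bne_of_notMem hv), List.takeWhile_cons_of_neg (by simp),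
    List.append_nil]

theorem mem_of_mem_inner {w : List ℕ} {i x : ℕ} (h : x ∈ inner w i) : x ∈ w :=
  (List.dropWhile_sublist _).subset (List.mem_of_mem_tail ((List.takeWhile_sublist _).subset h))

theorem inner_blockCons_self {b : ℕ} {l r : List ℕ} (h : b ∉ l) :
    inner (blockCons b l r) b = l :=
  inner_append_cons (u := []) List.not_mem_nil h

theorem inner_blockCons_left {b i : ℕ} {l r : List ℕ} (hb : i ≠ b) (h : 2 ≤ l.count i) :
    inner (blockCons b l r) i = inner l i := by
  obtain ⟨u, v, z, rfl, hu, hv⟩ := exists_eq_append_of_two_le_count h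
  have hbu : i ∉ b :: u := by simp [hb, hu]
  simpa [blockCons, inner_append_cons hu hv] using inner_append_cons (z := z ++ b :: r) hbu hv

theorem inner_blockCons_right {b i : ℕ} {l r : List ℕ} (hb : i ≠ b) (h : i ∉ l) :
    inner (blockCons b l r) i = inner r i := by
  have hbne : ∀ a ∈ b :: (l ++ [b]), (a != i) = true := fun a ha =>
    bne_iff_ne.2 (ne_of_mem_of_not_mem ha (by simp [hb, h]))
  have hassoc : blockCons b l r = (b :: (l ++ [b])) ++ r := by simp
  rw [inner, hassoc, List.dropWhile_append_of_pos hbne, inner]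

namespace IsStirling

variable {b : ℕ} {l r : List ℕ}

theorem nil : IsStirling [] := ⟨by simp, by simp⟩

theorem exists_eq_blockCons {w : List ℕ} (h : IsStirling (b :: w)) :
    ∃ l r, w = l ++ b :: r := by
  have hbw : w.count b = 1 := by simpa using h.count_eq b List.mem_cons_self
  exact List.append_of_mem (List.count_pos_iff.1 (by omega))

section

variable (h : IsStirling (blockCons b l r))
include h

theorem notMem_left : b ∉ l := by
  have := h.count_eq b List.mem_cons_self
  simp only [List.count_cons_self, List.count_append] at this
  exact List.count_eq_zero.1 (by omega)

theorem notMem_right : b ∉ r := by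
  have := h.count_eq b List.mem_cons_self
  simp only [List.count_cons_self, List.count_append] at this
  exact List.count_eq_zero.1 (by omega)

theorem inner_self : inner (blockCons b l r) b = l := inner_blockCons_self h.notMem_left

theorem lt_left : ∀ x ∈ l, b < x := fun x hx =>
  h.lt_of_mem_inner b List.mem_cons_self x (by rwa [h.inner_self])

theorem ne_of_mem_left {i : ℕ} (hi : i ∈ l) : i ≠ b := ne_of_mem_of_not_mem hi h.notMem_left

theorem ne_of_mem_right {i : ℕ} (hi : i ∈ r) : i ≠ b := ne_of_mem_of_not_mem hi h.notMem_right

theorem count_left_add_count_right {i : ℕ} (hi : i ≠ b) (hlr : i ∈ l ∨ i ∈ r) :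
    l.count i + r.count i = 2 := by
  have := h.count_eq i (by simp only [List.mem_cons, List.mem_append]; tauto)
  simpa [List.count_cons_of_ne hi.symm] using this

-- A common letter `x` would have the second `b` between its occurrences, although `b < x`.
theorem disjoint : List.Disjoint l r := by
  intro x hxl hxr
  have hxb := h.ne_of_mem_left hxl
  have hcount := h.count_left_add_count_right hxb (.inl hxl)
  obtain ⟨l₁, l₂, rfl, hl₁⟩ := List.eq_append_cons_of_mem hxl
  obtain ⟨r₁, r₂, rfl, hr₁⟩ := List.eq_append_cons_of_mem hxr
  have hl₂ : x ∉ l₂ := by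
    simp only [List.count_append, List.count_cons_self] at hcount
    exact List.count_eq_zero.1 (by omega)
  have hinner : inner (blockCons b (l₁ ++ x :: l₂) (r₁ ++ x :: r₂)) x = l₂ ++ b :: r₁ := by
    simpa [blockCons] using inner_append_cons (i := x) (u := b :: l₁) (v := l₂ ++ b :: r₁) (z := r₂)
      (by simp [hxb, hl₁]) (by simp [hxb, hl₂, hr₁])
  have hlt : x < b := h.lt_of_mem_inner x (by simp) b (by simp [hinner])
  exact hlt.not_gt (h.lt_left x hxl)

theorem notMem_left_of_mem_right {i : ℕ} (hi : i ∈ r) : i ∉ l := fun hl => h.disjoint hl hi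

theorem count_left_eq {i : ℕ} (hi : i ∈ l) : l.count i = 2 := by
  simpa [List.count_eq_zero_of_not_mem (h.disjoint hi)]
    using h.count_left_add_count_right (h.ne_of_mem_left hi) (.inl hi)

theorem count_right_eq {i : ℕ} (hi : i ∈ r) : r.count i = 2 := by
  simpa [List.count_eq_zero_of_not_mem (h.notMem_left_of_mem_right hi)]
    using h.count_left_add_count_right (h.ne_of_mem_right hi) (.inr hi)

theorem inner_left {i : ℕ} (hi : i ∈ l) : inner (blockCons b l r) i = inner l i :=
  inner_blockCons_left (h.ne_of_mem_left hi) (h.count_left_eq hi).ge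

theorem inner_right {i : ℕ} (hi : i ∈ r) : inner (blockCons b l r) i = inner r i :=
  inner_blockCons_right (h.ne_of_mem_right hi) (h.notMem_left_of_mem_right hi)

theorem left : IsStirling l where
  count_eq _ hi := h.count_left_eq hi
  lt_of_mem_inner i hi x hx := h.lt_of_mem_inner i (by simp [hi]) x (by rwa [h.inner_left hi])

theorem right : IsStirling r where
  count_eq _ hi := h.count_right_eq hi
  lt_of_mem_inner i hi x hx := h.lt_of_mem_inner i (by simp [hi]) x (by rwa [h.inner_right hi])

end

@[elab_as_elim]
theorem induction {P : ∀ w, IsStirling w → Prop} (nil : P [] nil)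
    (blockCons : ∀ b l r (h : IsStirling (blockCons b l r)), P l h.left → P r h.right →
      P (blockCons b l r) h)
    {w : List ℕ} (hw : IsStirling w) : P w hw := by
  induction hn : w.length using Nat.strong_induction_on generalizing w with
  | _ n ih =>
    rcases w with _ | ⟨b, w⟩
    · exact nil
    · obtain ⟨l, r, rfl⟩ := hw.exists_eq_blockCons
      simp only [List.length_cons, List.length_append] at hn
      exact blockCons b l r hw (ih _ (by omega) hw.left rfl) (ih _ (by omega) hw.right rfl)

end IsStirling

theorem isStirling_blockCons {b : ℕ} {l r : List ℕ} (hl : IsStirling l) (hr : IsStirling r)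
    (hbr : b ∉ r) (hlr : List.Disjoint l r) (hlt : ∀ x ∈ l, b < x) :
    IsStirling (blockCons b l r) := by
  have hbl : b ∉ l := fun h => lt_irrefl _ (hlt b h)
  have hcases : ∀ i ∈ blockCons b l r,
      i = b ∨ (i ≠ b ∧ i ∈ l ∧ i ∉ r) ∨ (i ≠ b ∧ i ∉ l ∧ i ∈ r) := by
    intro i hi
    have hdisj : i ∈ l → i ∉ r := fun h => hlr h
    simp only [List.mem_cons, List.mem_append] at hi
    tauto
  constructor
  · intro i hi
    obtain rfl | ⟨hib, hil, hir⟩ | ⟨hib, hil, hir⟩ := hcases i hi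
    · simp [List.count_eq_zero_of_not_mem hbl, List.count_eq_zero_of_not_mem hbr]
    · simp [List.count_cons_of_ne hib.symm, hl.count_eq i hil, List.count_eq_zero_of_not_mem hir]
    · simp [List.count_cons_of_ne hib.symm, hr.count_eq i hir, List.count_eq_zero_of_not_mem hil]
  · intro i hi x hx
    obtain rfl | ⟨hib, hil, hir⟩ | ⟨hib, hil, hir⟩ := hcases i hi
    · rw [inner_blockCons_self hbl] at hx
      exact hlt x hx
    · rw [inner_blockCons_left hib (hl.count_eq i hil).ge] at hx
      exact hl.lt_of_mem_inner i hil x hx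
    · rw [inner_blockCons_right hib hil] at hx
      exact hr.lt_of_mem_inner i hir x hx

/-- The Stirling words with set of letters `S`. -/
def stirlingOn (S : Finset ℕ) : Finset (List ℕ) :=
  {w ∈ (Multiset.lists (2 • S.val)).toFinset | ∀ i ∈ S, ∀ x ∈ inner w i, i < x}

theorem stirling_eq_stirlingOn (n : ℕ) : stirling n = stirlingOn (Finset.Icc 1 n) := rfl

theorem mem_stirlingOn {S : Finset ℕ} {w : List ℕ} :
    w ∈ stirlingOn S ↔ IsStirling w ∧ w.toFinset = S := by
  have coe_eq_iff : 2 • S.val = (w : Multiset ℕ) ↔ ∀ i, w.count i = if i ∈ S then 2 else 0 := by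
    rw [Multiset.ext]
    refine forall_congr' fun i => ?_
    rw [Multiset.count_nsmul, Multiset.coe_count, Multiset.count_eq_of_nodup S.nodup]
    simp only [Finset.mem_val]
    split_ifs <;> omega
  rw [stirlingOn, Finset.mem_filter, Multiset.mem_toFinset, Multiset.mem_lists_iff]
  change 2 • S.val = (w : Multiset ℕ) ∧ _ ↔ _
  rw [coe_eq_iff]
  constructor
  · rintro ⟨hcount, hlt⟩
    have mem_iff (i : ℕ) : i ∈ w ↔ i ∈ S := by
      rw [← List.count_pos_iff, hcount]
      split_ifs with h <;> simp [h]
    exact ⟨⟨fun i hi => by simp [hcount, (mem_iff i).1 hi], fun i hi => hlt i ((mem_iff i).1 hi)⟩,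
      by ext i; simp [mem_iff]⟩
  · rintro ⟨hw, rfl⟩
    refine ⟨fun i => ?_, fun i hi => hw.lt_of_mem_inner i (by simpa using hi)⟩
    split_ifs with h
    · exact hw.count_eq i (by simpa using h)
    · exact List.count_eq_zero_of_not_mem (by simpa using h)

/-! ### Levels of blocks -/

theorem self_mem_block (w : List ℕ) (i : ℕ) : i ∈ block w i := List.mem_cons_self

theorem block_infix {w : List ℕ} {i : ℕ} (h : 2 ≤ w.count i) : block w i <:+: w := by
  obtain ⟨u, v, z, rfl, hu, hv⟩ := exists_eq_append_of_two_le_count h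
  rw [block, inner_append_cons hu hv]
  exact ⟨u, z, by simp⟩

theorem IsLevel.mem {w : List ℕ} {ℓ i : ℕ} (h : IsLevel w ℓ i) : i ∈ w := by
  match ℓ, h with
  | 1, h => exact h.1
  | _ + 2, ⟨_, _, _, h⟩ => exact mem_of_mem_inner h.1

theorem not_isLevel_zero {w : List ℕ} {i : ℕ} : ¬ IsLevel w 0 i := id

theorem finite_setOf_isLevel (w : List ℕ) (ℓ : ℕ) : {i | IsLevel w ℓ i}.Finite :=
  w.toFinset.finite_toSet.subset fun i hi => by simpa using IsLevel.mem hi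

theorem finite_setOf_isBlockOccurrence (p : Pattern) (ℓ : ℕ) (w : List ℕ) :
    {c | p.IsBlockOccurrence ℓ w c}.Finite :=
  (Set.Finite.pi' fun _ => finite_setOf_isLevel w ℓ).subset fun _ hc => hc.2.1

theorem bl_nil (ℓ : ℕ) : bl ℓ [] = 0 := by
  rw [bl, Set.ncard_eq_zero (finite_setOf_isLevel _ _), Set.eq_empty_iff_forall_notMem]
  exact fun i hi => List.not_mem_nil hi.mem

theorem blockCount_nil (p : Pattern) (ℓ : ℕ) : p.blockCount ℓ [] = 0 := by
  rw [Pattern.blockCount, Set.ncard_eq_zero (finite_setOf_isBlockOccurrence ..),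
    Set.eq_empty_iff_forall_notMem]
  exact fun c hc => List.not_mem_nil (hc.2.1 ⟨0, hc.1⟩).mem

theorem IsParent.mem_left {w : List ℕ} {i j : ℕ} (h : IsParent w j i) : j ∈ w :=
  let ⟨_, hj, _⟩ := h
  hj.mem

theorem IsParent.mem_right {w : List ℕ} {i j : ℕ} (h : IsParent w j i) : i ∈ w :=
  let ⟨_, _, hi, _⟩ := h
  hi.mem

theorem Siblings.mem_left {w : List ℕ} {i j : ℕ} : Siblings w i j → i ∈ w
  | .inl h => h.1.mem
  | .inr ⟨_, h⟩ => h.1.mem_right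

theorem Siblings.mem_right {w : List ℕ} {i j : ℕ} : Siblings w i j → j ∈ w
  | .inl h => h.2.mem
  | .inr ⟨_, h⟩ => h.2.mem_right

namespace IsStirling

theorem block_infix_block {w : List ℕ} (hw : IsStirling w) {i j : ℕ} (hj : j ∈ w)
    (hi : i ∈ inner w j) : block w i <:+: block w j := by
  induction hw using IsStirling.induction with
  | nil => simp at hj
  | blockCons b l r h ihl ihr =>
    have self_case (hi : i ∈ inner (blockCons b l r) b) :
        block (blockCons b l r) i <:+: block (blockCons b l r) b := by
      rw [h.inner_self] at hi
      rw [block, block, h.inner_left hi, h.inner_self, ← block]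
      exact (block_infix (h.count_left_eq hi).ge).trans ⟨[b], [b], by simp⟩
    simp only [List.mem_cons, List.mem_append] at hj
    rcases hj with rfl | hj | rfl | hj
    · exact self_case hi
    · rw [h.inner_left hj] at hi
      rw [block, block, h.inner_left (mem_of_mem_inner hi), h.inner_left hj]
      exact ihl hj hi
    · exact self_case hi
    · rw [h.inner_right hj] at hi
      rw [block, block, h.inner_right (mem_of_mem_inner hi), h.inner_right hj]
      exact ihr hj hi

section

variable {w : List ℕ} (hw : IsStirling w)
include hw

theorem sub_iff {i j : ℕ} (hj : j ∈ w) : Sub w i j ↔ i ∈ inner w j := by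
  constructor
  · rintro ⟨hij, hsub⟩
    simpa [block, hij] using hsub.subset (self_mem_block w i)
  · exact fun hi => ⟨(hw.lt_of_mem_inner j hj i hi).ne', hw.block_infix_block hj hi⟩

theorem isLevelOne_iff {i : ℕ} : IsLevelOne w i ↔ i ∈ w ∧ ¬ ∃ j ∈ w, i ∈ inner w j :=
  and_congr_right' <| not_congr <| exists_congr fun _ => and_congr_right hw.sub_iff

theorem isLevel_add_two_iff {ℓ i : ℕ} :
    IsLevel w (ℓ + 2) i ↔ ∃ j, IsLevel w (ℓ + 1) j ∧ IsLevel (inner w j) 1 i :=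
  exists_congr fun _ => and_congr_right fun hj =>
    and_iff_right_of_imp fun hi => (hw.sub_iff hj.mem).2 hi.1

theorem isParent_iff {i j : ℕ} :
    IsParent w j i ↔ ∃ ℓ, IsLevel w ℓ j ∧ IsLevel w (ℓ + 1) i ∧ i ∈ inner w j :=
  exists_congr fun _ => and_congr_right fun hj => and_congr_right' (hw.sub_iff hj.mem)

end

variable {b : ℕ} {l r : List ℕ} (h : IsStirling (blockCons b l r))
include h

theorem isLevel_one_blockCons_iff {i : ℕ} :
    IsLevel (blockCons b l r) 1 i ↔ i = b ∨ IsLevel r 1 i := by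
  have exists_iff : (∃ j ∈ blockCons b l r, i ∈ inner (blockCons b l r) j) ↔
      i ∈ l ∨ ∃ j ∈ r, i ∈ inner r j := by
    constructor
    · rintro ⟨j, hj, hi⟩
      obtain rfl | hj | hj : j = b ∨ j ∈ l ∨ j ∈ r := by
        simp only [List.mem_cons, List.mem_append] at hj
        tauto
      · exact .inl (by rwa [h.inner_self] at hi)
      · exact .inl (mem_of_mem_inner (by rwa [h.inner_left hj] at hi))
      · exact .inr ⟨j, hj, by rwa [h.inner_right hj] at hi⟩
    · rintro (hi | ⟨j, hj, hi⟩)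
      · exact ⟨b, List.mem_cons_self, by rwa [h.inner_self]⟩
      · exact ⟨j, by simp [hj], by rwa [h.inner_right hj]⟩
  have hbr : ¬ ∃ j ∈ r, b ∈ inner r j := fun ⟨_, _, hb⟩ => h.notMem_right (mem_of_mem_inner hb)
  change IsLevelOne _ i ↔ _ ∨ IsLevelOne _ i
  rw [h.isLevelOne_iff, h.right.isLevelOne_iff, exists_iff, List.mem_cons, List.mem_append,
    List.mem_cons]
  by_cases hib : i = b
  · simp [hib, hbr, h.notMem_left]
  · have hr : i ∈ r → i ∉ l := h.notMem_left_of_mem_right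
    simp only [hib, false_or, not_or]
    grind

theorem isLevel_add_two_blockCons_iff {ℓ i : ℕ} :
    IsLevel (blockCons b l r) (ℓ + 2) i ↔ IsLevel l (ℓ + 1) i ∨ IsLevel r (ℓ + 2) i := by
  have right_iff (m i : ℕ) :
      (∃ j, IsLevel r m j ∧ IsLevel (inner (blockCons b l r) j) 1 i) ↔
        ∃ j, IsLevel r m j ∧ IsLevel (inner r j) 1 i :=
    exists_congr fun _ => and_congr_right fun hj => by rw [h.inner_right hj.mem]
  have left_iff (m i : ℕ) :
      (∃ j, IsLevel l m j ∧ IsLevel (inner (blockCons b l r) j) 1 i) ↔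
        ∃ j, IsLevel l m j ∧ IsLevel (inner l j) 1 i :=
    exists_congr fun _ => and_congr_right fun hj => by rw [h.inner_left hj.mem]
  induction ℓ generalizing i with
  | zero =>
    simp only [h.isLevel_add_two_iff, h.right.isLevel_add_two_iff, zero_add,
      h.isLevel_one_blockCons_iff, or_and_right, exists_or, exists_eq_left, h.inner_self,
      right_iff]
  | succ ℓ ih =>
    rw [h.isLevel_add_two_iff, h.left.isLevel_add_two_iff, h.right.isLevel_add_two_iff]
    simp only [ih, or_and_right, exists_or, left_iff, right_iff]

theorem isLevel_right_iff {ℓ i : ℕ} (hi : i ∈ r) :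
    IsLevel (blockCons b l r) ℓ i ↔ IsLevel r ℓ i := by
  rcases ℓ with _ | _ | ℓ
  · exact Iff.rfl
  · rw [zero_add, h.isLevel_one_blockCons_iff, or_iff_right (h.ne_of_mem_right hi)]
  · rw [h.isLevel_add_two_blockCons_iff, or_iff_right]
    exact fun hl => h.notMem_left_of_mem_right hi hl.mem

theorem isLevel_left_iff {ℓ i : ℕ} (hi : i ∈ l) :
    IsLevel (blockCons b l r) (ℓ + 1) i ↔ IsLevel l ℓ i := by
  rcases ℓ with _ | ℓ
  · rw [zero_add, h.isLevel_one_blockCons_iff, iff_false_right not_isLevel_zero]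
    rintro (rfl | hr)
    · exact h.notMem_left hi
    · exact h.disjoint hi hr.mem
  · rw [h.isLevel_add_two_blockCons_iff, or_iff_left]
    exact fun hr => h.disjoint hi hr.mem

theorem isLevel_self_iff {ℓ : ℕ} : IsLevel (blockCons b l r) ℓ b ↔ ℓ = 1 := by
  rcases ℓ with _ | _ | ℓ
  · simp [not_isLevel_zero]
  · simp [h.isLevel_one_blockCons_iff]
  · rw [h.isLevel_add_two_blockCons_iff]
    refine iff_of_false ?_ (by omega)
    rintro (hl | hr)
    · exact h.notMem_left hl.mem
    · exact h.notMem_right hr.mem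

theorem isParent_blockCons_iff {i j : ℕ} :
    IsParent (blockCons b l r) j i ↔ (j = b ∧ IsLevel l 1 i) ∨ IsParent l j i ∨ IsParent r j i := by
  rw [h.isParent_iff, h.left.isParent_iff, h.right.isParent_iff]
  constructor
  · rintro ⟨ℓ, hj, hi, hij⟩
    obtain rfl | hjl | hjr : j = b ∨ j ∈ l ∨ j ∈ r := by
      simpa [or_left_comm (a := j ∈ l)] using hj.mem
    · obtain rfl := h.isLevel_self_iff.1 hj
      rw [h.inner_self] at hij
      exact .inl ⟨rfl, (h.isLevel_left_iff hij).1 hi⟩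
    · rcases ℓ with _ | ℓ
      · exact absurd hj not_isLevel_zero
      rw [h.inner_left hjl] at hij
      exact .inr <| .inl ⟨ℓ, (h.isLevel_left_iff hjl).1 hj,
        (h.isLevel_left_iff (mem_of_mem_inner hij)).1 hi, hij⟩
    · rw [h.inner_right hjr] at hij
      exact .inr <| .inr ⟨ℓ, (h.isLevel_right_iff hjr).1 hj,
        (h.isLevel_right_iff (mem_of_mem_inner hij)).1 hi, hij⟩
  · rintro (⟨rfl, hi⟩ | ⟨ℓ, hj, hi, hij⟩ | ⟨ℓ, hj, hi, hij⟩)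
    · exact ⟨1, h.isLevel_self_iff.2 rfl, (h.isLevel_left_iff hi.mem).2 hi,
        by rw [h.inner_self]; exact hi.mem⟩
    · exact ⟨ℓ + 1, (h.isLevel_left_iff hj.mem).2 hj, (h.isLevel_left_iff hi.mem).2 hi,
        by rwa [h.inner_left hj.mem]⟩
    · exact ⟨ℓ, (h.isLevel_right_iff hj.mem).2 hj, (h.isLevel_right_iff hi.mem).2 hi,
        by rwa [h.inner_right hj.mem]⟩

theorem siblings_blockCons_iff {i j : ℕ} :
    Siblings (blockCons b l r) i j ↔
      (IsLevel (blockCons b l r) 1 i ∧ IsLevel (blockCons b l r) 1 j) ∨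
        Siblings l i j ∨ ∃ k, IsParent r k i ∧ IsParent r k j := by
  refine or_congr_right ?_
  simp only [Siblings, h.isParent_blockCons_iff]
  constructor
  · rintro ⟨k, hi, hj⟩
    have hbl : k = b → k ∉ l := by rintro rfl; exact h.notMem_left
    have hbr : k = b → k ∉ r := by rintro rfl; exact h.notMem_right
    have hlr : k ∈ l → k ∉ r := fun hk => h.disjoint hk
    rcases hi with ⟨hk, hi⟩ | hi | hi <;> rcases hj with ⟨hk', hj⟩ | hj | hj
    · exact .inl (.inl ⟨hi, hj⟩)
    · exact absurd hj.mem_left (hbl hk)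
    · exact absurd hj.mem_left (hbr hk)
    · exact absurd hi.mem_left (hbl hk')
    · exact .inl (.inr ⟨k, hi, hj⟩)
    · exact absurd hj.mem_left (hlr hi.mem_left)
    · exact absurd hi.mem_left (hbr hk')
    · exact absurd hi.mem_left (hlr hj.mem_left)
    · exact .inr ⟨k, hi, hj⟩
  · rintro ((⟨hi, hj⟩ | ⟨k, hi, hj⟩) | ⟨k, hi, hj⟩)
    · exact ⟨b, .inl ⟨rfl, hi⟩, .inl ⟨rfl, hj⟩⟩
    · exact ⟨k, .inr (.inl hi), .inr (.inl hj)⟩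
    · exact ⟨k, .inr (.inr hi), .inr (.inr hj)⟩

theorem siblings_right_iff {i j : ℕ} (hi : i ∈ r) (hj : j ∈ r) :
    Siblings (blockCons b l r) i j ↔ Siblings r i j := by
  rw [h.siblings_blockCons_iff, h.isLevel_right_iff hi, h.isLevel_right_iff hj,
    or_iff_right fun hs : Siblings l i j => h.disjoint hs.mem_left hi]
  rfl

theorem siblings_left_iff {i j : ℕ} (hi : i ∈ l) (hj : j ∈ l) :
    Siblings (blockCons b l r) i j ↔ Siblings l i j := by
  rw [h.siblings_blockCons_iff, h.isLevel_left_iff hi, h.isLevel_left_iff hj,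
    or_iff_right fun hs => not_isLevel_zero hs.1,
    or_iff_left fun ⟨_, hk, _⟩ => h.disjoint hi hk.mem_right]

theorem not_siblings {i j : ℕ} (hi : i ∈ l) (hj : j ∈ r) :
    ¬ Siblings (blockCons b l r) i j := by
  rw [h.siblings_blockCons_iff, h.isLevel_left_iff hi]
  rintro (hs | hs | ⟨k, hk, -⟩)
  · exact not_isLevel_zero hs.1
  · exact h.disjoint hs.mem_right hj
  · exact h.disjoint hi hk.mem_right

theorem firstPos_left {i : ℕ} (hi : i ∈ l) :
    firstPos (blockCons b l r) i = firstPos l i + 1 := by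
  simp [firstPos, List.idxOf_cons_ne _ (h.ne_of_mem_left hi).symm, List.idxOf_append_of_mem hi]

theorem firstPos_right {i : ℕ} (hi : i ∈ r) :
    firstPos (blockCons b l r) i = firstPos r i + (l.length + 2) := by
  rw [firstPos, List.idxOf_cons_ne _ (h.ne_of_mem_right hi).symm,
    List.idxOf_append_of_notMem (h.notMem_left_of_mem_right hi),
    List.idxOf_cons_ne _ (h.ne_of_mem_right hi).symm, firstPos]
  omega

theorem secondPos_left {i : ℕ} (hi : i ∈ l) :
    secondPos (blockCons b l r) i = secondPos l i + 1 := by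
  have := h.firstPos_left hi
  simp only [firstPos] at this
  rw [secondPos, secondPos, h.inner_left hi, this]
  omega

theorem secondPos_right {i : ℕ} (hi : i ∈ r) :
    secondPos (blockCons b l r) i = secondPos r i + (l.length + 2) := by
  have := h.firstPos_right hi
  simp only [firstPos] at this
  rw [secondPos, secondPos, h.inner_right hi, this]
  omega

theorem isBlockOccurrence_left_iff {p : Pattern} {ℓ : ℕ} {c : Fin p.len → ℕ} (hc : ∀ j, c j ∈ l) :
    p.IsBlockOccurrence (ℓ + 1) (blockCons b l r) c ↔ p.IsBlockOccurrence ℓ l c := by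
  simp only [Pattern.IsBlockOccurrence, StrictMono, h.isLevel_left_iff (hc _),
    h.firstPos_left (hc _), h.secondPos_left (hc _), h.siblings_left_iff (hc _) (hc _),
    add_lt_add_iff_right, add_left_inj]

theorem isBlockOccurrence_right_iff {p : Pattern} {ℓ : ℕ} {c : Fin p.len → ℕ}
    (hc : ∀ j, c j ∈ r) :
    p.IsBlockOccurrence ℓ (blockCons b l r) c ↔ p.IsBlockOccurrence ℓ r c := by
  simp only [Pattern.IsBlockOccurrence, StrictMono, h.isLevel_right_iff (hc _),
    h.firstPos_right (hc _), h.secondPos_right (hc _), h.siblings_right_iff (hc _) (hc _),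
    add_lt_add_iff_right, add_right_comm _ (l.length + 2) 1, add_left_inj]

-- Siblings never straddle the end of the first block.
theorem isBlockOccurrence_add_two_iff {p : Pattern} {ℓ : ℕ} {c : Fin p.len → ℕ} :
    p.IsBlockOccurrence (ℓ + 2) (blockCons b l r) c ↔
      p.IsBlockOccurrence (ℓ + 1) l c ∨ p.IsBlockOccurrence (ℓ + 2) r c := by
  constructor
  · intro hocc
    have ⟨hlen, hlevel, _, hsib, _⟩ := hocc
    have hmem (j : Fin p.len) : c j ∈ l ∨ c j ∈ r :=
      (h.isLevel_add_two_blockCons_iff.1 (hlevel j)).imp IsLevel.mem IsLevel.mem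
    rcases hmem ⟨0, hlen⟩ with h0 | h0
    · exact .inl ((h.isBlockOccurrence_left_iff fun j =>
        (hmem j).resolve_right fun hj => h.not_siblings h0 hj (hsib _ _)).1 hocc)
    · exact .inr ((h.isBlockOccurrence_right_iff fun j =>
        (hmem j).resolve_left fun hj => h.not_siblings hj h0 (hsib _ _)).1 hocc)
  · rintro (hocc | hocc)
    · exact (h.isBlockOccurrence_left_iff fun j => (hocc.2.1 j).mem).2 hocc
    · exact (h.isBlockOccurrence_right_iff fun j => (hocc.2.1 j).mem).2 hocc

theorem blockCount_add_two (p : Pattern) (ℓ : ℕ) :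
    p.blockCount (ℓ + 2) (blockCons b l r) =
      p.blockCount (ℓ + 1) l + p.blockCount (ℓ + 2) r := by
  have hdisj : Disjoint {c | p.IsBlockOccurrence (ℓ + 1) l c}
      {c | p.IsBlockOccurrence (ℓ + 2) r c} := Set.disjoint_left.2 fun c hl hr =>
    h.disjoint (hl.2.1 ⟨0, hl.1⟩).mem (hr.2.1 ⟨0, hl.1⟩).mem
  simp only [Pattern.blockCount, h.isBlockOccurrence_add_two_iff, Set.ofPred_or]
  exact Set.ncard_union_eq hdisj (finite_setOf_isBlockOccurrence ..)
    (finite_setOf_isBlockOccurrence ..)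

theorem bl_add_two (ℓ : ℕ) : bl (ℓ + 2) (blockCons b l r) = bl (ℓ + 1) l + bl (ℓ + 2) r := by
  have hdisj : Disjoint {i | IsLevel l (ℓ + 1) i} {i | IsLevel r (ℓ + 2) i} :=
    Set.disjoint_left.2 fun i hl hr => h.disjoint hl.mem hr.mem
  simp only [bl, h.isLevel_add_two_blockCons_iff, Set.ofPred_or]
  exact Set.ncard_union_eq hdisj (finite_setOf_isLevel ..) (finite_setOf_isLevel ..)

end IsStirling

/-! ### Blocks of level `1` -/

/-- The level `1` blocks of a Stirling word from left to right, each given by its letter `b` and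
the string strictly between the two occurrences of `b`. -/
def blocks : List ℕ → List (ℕ × List ℕ)
  | [] => []
  | b :: w => (b, inner (b :: w) b) :: blocks (w.dropWhile (· != b)).tail
termination_by w => w.length
decreasing_by
  have := (List.dropWhile_sublist (l := w) (· != b)).length_le
  simp only [List.length_cons, List.length_tail]
  omega

/-- The letters of the level `1` blocks of a Stirling word from left to right. -/
def tops (w : List ℕ) : List ℕ := (blocks w).map Prod.fst

theorem blocks_nil : blocks [] = [] := by rw [blocks]

theorem blocks_blockCons {b : ℕ} {l r : List ℕ} (h : b ∉ l) :
    blocks (blockCons b l r) = (b, l) :: blocks r := by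
  have hbne : ∀ a ∈ l, (a != b) = true := fun a ha => bne_iff_ne.2 (ne_of_mem_of_not_mem ha h)
  rw [blockCons, blocks, inner_blockCons_self h, List.dropWhile_append_of_pos hbne,
    List.dropWhile_cons_of_neg (by simp), List.tail_cons]

theorem tops_nil : tops [] = [] := by rw [tops, blocks_nil, List.map_nil]

theorem tops_blockCons {b : ℕ} {l r : List ℕ} (h : b ∉ l) :
    tops (blockCons b l r) = b :: tops r := by
  rw [tops, blocks_blockCons h, List.map_cons, ← tops]

theorem firstPos_of_mem_head?_tops {w : List ℕ} {i : ℕ} (h : i ∈ (tops w).head?) :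
    firstPos w i = 0 := by
  cases w with
  | nil => simp [tops_nil] at h
  | cons b w =>
    obtain rfl : b = i := by simpa [tops, blocks] using h
    exact List.idxOf_cons_self

/-- The number of occurrences of `p` in the word `s`. -/
def Pattern.listCount (p : Pattern) (s : List ℕ) : ℕ :=
  {i : Fin p.len → Fin s.length | p.IsOccurrence s.get i}.ncard

namespace IsStirling

section

variable {w : List ℕ} (hw : IsStirling w)
include hw

theorem mem_tops_iff {i : ℕ} : i ∈ tops w ↔ IsLevel w 1 i := by
  induction hw using IsStirling.induction with
  | nil =>
    rw [tops_nil]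
    exact iff_of_false List.not_mem_nil fun h => List.not_mem_nil h.mem
  | blockCons b l r h _ ihr =>
    rw [tops_blockCons h.notMem_left, h.isLevel_one_blockCons_iff, List.mem_cons, ihr]

theorem mem_of_mem_tops {i : ℕ} (hi : i ∈ tops w) : i ∈ w := (hw.mem_tops_iff.1 hi).mem

theorem pairwise_firstPos_tops : (tops w).Pairwise fun i j => firstPos w i < firstPos w j := by
  induction hw using IsStirling.induction with
  | nil => simp [tops_nil]
  | blockCons b l r h _ ihr =>
    have hmem {i : ℕ} (hi : i ∈ tops r) : i ∈ r := h.right.mem_of_mem_tops hi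
    rw [tops_blockCons h.notMem_left, List.pairwise_cons]
    refine ⟨fun j hj => ?_, ihr.imp_of_mem fun hi hj hij => ?_⟩
    · rw [h.firstPos_right (hmem hj)]
      simp [firstPos]
    · rwa [h.firstPos_right (hmem hi), h.firstPos_right (hmem hj), add_lt_add_iff_right]

theorem isChain_tops : (tops w).IsChain fun i j => firstPos w j = secondPos w i + 1 := by
  induction hw using IsStirling.induction with
  | nil => simp [tops_nil]
  | blockCons b l r h _ ihr =>
    have hmem {i : ℕ} (hi : i ∈ tops r) : i ∈ r := h.right.mem_of_mem_tops hi
    rw [tops_blockCons h.notMem_left, List.isChain_cons]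
    refine ⟨fun j hj => ?_, ihr.imp_of_mem_imp fun i j hi hj hij => ?_⟩
    · rw [h.firstPos_right (hmem (List.mem_of_mem_head? hj)), firstPos_of_mem_head?_tops hj,
        secondPos, h.inner_self, List.idxOf_cons_self]
      omega
    · rw [h.firstPos_right (hmem hj), h.secondPos_right (hmem hi), hij]
      omega

theorem nodup_tops : (tops w).Nodup :=
  hw.pairwise_firstPos_tops.imp fun h => by rintro rfl; exact lt_irrefl _ h

theorem bl_one : bl 1 w = (tops w).length := by
  have hset : {i | IsLevel w 1 i} = (tops w).toFinset := by
    ext i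
    simp [← hw.mem_tops_iff]
  rw [bl, hset, Set.ncard_coe_finset, List.toFinset_card_of_nodup hw.nodup_tops]

theorem strictMono_firstPos_tops : StrictMono fun j => firstPos w ((tops w).get j) :=
  fun j k hjk => List.pairwise_iff_get.1 hw.pairwise_firstPos_tops j k hjk

theorem firstPos_tops_eq_iff {j k : Fin (tops w).length} :
    firstPos w ((tops w).get k) = secondPos w ((tops w).get j) + 1 ↔ (k : ℕ) = j + 1 := by
  have hchain := List.isChain_iff_getElem.1 hw.isChain_tops
  constructor
  · intro hkj
    have hlt : j < k := hw.strictMono_firstPos_tops.lt_iff_lt.1 <| by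
      rw [hkj, firstPos, secondPos]
      omega
    have hj : (j : ℕ) + 1 < (tops w).length := by omega
    have hinj := hw.strictMono_firstPos_tops.injective (a₁ := k) (a₂ := ⟨j + 1, hj⟩)
      (hkj.trans (hchain j hj).symm)
    exact congrArg Fin.val hinj
  · intro hk
    have hj : (j : ℕ) + 1 < (tops w).length := hk ▸ k.2
    rw [show k = ⟨j + 1, hj⟩ from Fin.ext hk]
    exact hchain j hj

theorem isBlockOccurrence_one_iff (p : Pattern) (i : Fin p.len → Fin (tops w).length) :
    p.IsBlockOccurrence 1 w (fun j => (tops w).get (i j)) ↔ p.IsOccurrence (tops w).get i := by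
  have hlevel (j : Fin (tops w).length) : IsLevel w 1 ((tops w).get j) :=
    hw.mem_tops_iff.1 (List.get_mem _ _)
  have hsib (j k : Fin (tops w).length) : Siblings w ((tops w).get j) ((tops w).get k) :=
    .inl ⟨hlevel j, hlevel k⟩
  simp only [Pattern.IsBlockOccurrence, Pattern.IsOccurrence, StrictMono,
    hw.strictMono_firstPos_tops.lt_iff_lt, hlevel, hsib, hw.firstPos_tops_eq_iff, implies_true,
    true_and]

theorem blockCount_one (p : Pattern) : p.blockCount 1 w = p.listCount (tops w) := by
  have hinj : Function.Injective
      fun (i : Fin p.len → Fin (tops w).length) j => (tops w).get (i j) :=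
    (List.nodup_iff_injective_get.1 hw.nodup_tops).comp_left
  rw [Pattern.blockCount, Pattern.listCount, ← Set.ncard_image_of_injective _ hinj]
  congr 1
  ext c
  constructor
  · intro hc
    have hget (j : Fin p.len) : ∃ i, (tops w).get i = c j :=
      List.mem_iff_get.1 (hw.mem_tops_iff.2 (hc.2.1 j))
    choose i hi using hget
    obtain rfl : (fun j => (tops w).get (i j)) = c := funext hi
    exact ⟨i, (hw.isBlockOccurrence_one_iff p i).1 hc, rfl⟩
  · rintro ⟨i, hi, rfl⟩
    exact (hw.isBlockOccurrence_one_iff p i).2 hi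

end

end IsStirling

/-! ### Weights of Stirling words -/

theorem finprod_eq_zero_mul_finprod_succ {M : Type*} [CommMonoid M] {φ : ℕ → M}
    (h : φ.HasFiniteMulSupport) : ∏ᶠ i, φ i = φ 0 * ∏ᶠ i, φ (i + 1) := by
  obtain ⟨N, hN⟩ := h.bddAbove
  have hφ : φ.mulSupport ⊆ Finset.range (N + 1) := fun i hi => by
    simpa [Nat.lt_succ_iff] using hN hi
  have hφsucc : (fun i => φ (i + 1)).mulSupport ⊆ Finset.range N := fun i hi => by
    simpa using hN hi
  rw [finprod_eq_prod_of_mulSupport_subset _ hφ, finprod_eq_prod_of_mulSupport_subset _ hφsucc,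
    Finset.prod_range_succ', mul_comm]

section Weights

variable {R : Type*} [CommSemiring R]

/-- The product of `ω l` over the level `1` blocks `b l b` of `w`. -/
def blockProd (ω : List ℕ → R) (w : List ℕ) : R :=
  ((blocks w).map fun c => ω c.2).prod

theorem blockProd_nil (ω : List ℕ → R) : blockProd ω [] = 1 := by
  rw [blockProd, blocks_nil, List.map_nil, List.prod_nil]

theorem blockProd_blockCons (ω : List ℕ → R) {b : ℕ} {l r : List ℕ} (h : b ∉ l) :
    blockProd ω (blockCons b l r) = ω l * blockProd ω r := by
  rw [blockProd, blocks_blockCons h, List.map_cons, List.prod_cons, ← blockProd]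

open Classical in
/-- The contribution of the pattern conditions at one level to a weight, when `c q` is the number
of occurrences of the pattern `q` at that level. -/
def countWeight (A : Set Pattern) (p : Pattern) (z : R) (c : Pattern → ℕ) : R :=
  if ∀ a ∈ A, c a = 0 then z ^ c p else 0

theorem countWeight_zero (A : Set Pattern) (p : Pattern) (z : R) : countWeight A p z 0 = 1 := by
  simp [countWeight]

open Classical in
theorem countWeight_add (A : Set Pattern) (p : Pattern) (z : R) (c d : Pattern → ℕ) :
    countWeight A p z (c + d) = countWeight A p z c * countWeight A p z d := by
  have havoid : (∀ a ∈ A, (c + d) a = 0) ↔ (∀ a ∈ A, c a = 0) ∧ ∀ a ∈ A, d a = 0 := by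
    simp only [Pi.add_apply, Nat.add_eq_zero_iff, forall_and]
  simp only [countWeight]
  rw [ite_zero_mul_ite_zero, ← pow_add]
  exact if_congr havoid rfl rfl

/-- The contribution of the level `i + 1` blocks to the weight of `w`. -/
def levelWeight (A : ℕ → Set Pattern) (p : ℕ → Pattern) (x y : ℕ → R) (w : List ℕ) (i : ℕ) : R :=
  countWeight (A i) (p i) (x i) (fun q => q.blockCount (i + 1) w) * y i ^ bl (i + 1) w

/-- The weight with which `w` contributes to `g_n^{A,p}(x; y)`, namely `0` if `w` contains a
forbidden pattern. -/
def weight (A : ℕ → Set Pattern) (p : ℕ → Pattern) (x y : ℕ → R) (w : List ℕ) : R :=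
  ∏ᶠ i, levelWeight A p x y w i

theorem levelWeight_nil (A : ℕ → Set Pattern) (p : ℕ → Pattern) (x y : ℕ → R) (i : ℕ) :
    levelWeight A p x y [] i = 1 := by
  rw [levelWeight, bl_nil, pow_zero, mul_one]
  simp only [blockCount_nil]
  exact countWeight_zero ..

theorem weight_nil (A : ℕ → Set Pattern) (p : ℕ → Pattern) (x y : ℕ → R) :
    weight A p x y [] = 1 := by
  simp only [weight, levelWeight_nil, finprod_one]

theorem levelWeight_succ_blockCons {b : ℕ} {l r : List ℕ} (h : IsStirling (blockCons b l r))
    (A : ℕ → Set Pattern) (p : ℕ → Pattern) (x y : ℕ → R) (i : ℕ) :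
    levelWeight A p x y (blockCons b l r) (i + 1) =
      levelWeight (sh A) (sh p) (sh x) (sh y) l i * levelWeight A p x y r (i + 1) := by
  have hcount : (fun q : Pattern => q.blockCount (i + 2) (blockCons b l r)) =
      (fun q => q.blockCount (i + 1) l) + fun q => q.blockCount (i + 2) r :=
    funext fun q => h.blockCount_add_two q i
  rw [levelWeight, levelWeight, levelWeight, hcount, countWeight_add, h.bl_add_two, pow_add,
    mul_mul_mul_comm]
  rfl

section

variable {w : List ℕ} (hw : IsStirling w)
include hw

theorem levelWeight_eq_one_of_length_le (A : ℕ → Set Pattern) (p : ℕ → Pattern) (x y : ℕ → R)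
    {i : ℕ} (hi : w.length ≤ i) : levelWeight A p x y w i = 1 := by
  induction hw using IsStirling.induction generalizing A p x y i with
  | nil => exact levelWeight_nil ..
  | blockCons b l r h ihl ihr =>
    simp only [List.length_cons, List.length_append] at hi
    obtain ⟨i, rfl⟩ := Nat.exists_eq_add_of_lt (show 0 < i by omega)
    rw [zero_add, levelWeight_succ_blockCons h, ihl _ _ _ _ (by omega), ihr _ _ _ _ (by omega),
      mul_one]

theorem hasFiniteMulSupport_levelWeight (A : ℕ → Set Pattern) (p : ℕ → Pattern) (x y : ℕ → R) :
    (levelWeight A p x y w).HasFiniteMulSupport :=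
  (Set.finite_lt_nat w.length).subset fun i hi => by
    by_contra! hle
    exact hi (levelWeight_eq_one_of_length_le hw A p x y (not_lt.1 hle))

theorem hasFiniteMulSupport_levelWeight_succ (A : ℕ → Set Pattern) (p : ℕ → Pattern)
    (x y : ℕ → R) : (fun i => levelWeight A p x y w (i + 1)).HasFiniteMulSupport :=
  (hasFiniteMulSupport_levelWeight hw A p x y).comp_of_injective (add_left_injective 1)

end

theorem finprod_levelWeight_succ_blockCons {b : ℕ} {l r : List ℕ}
    (h : IsStirling (blockCons b l r)) (A : ℕ → Set Pattern) (p : ℕ → Pattern) (x y : ℕ → R) :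
    ∏ᶠ i, levelWeight A p x y (blockCons b l r) (i + 1) =
      weight (sh A) (sh p) (sh x) (sh y) l * ∏ᶠ i, levelWeight A p x y r (i + 1) := by
  simp only [levelWeight_succ_blockCons h]
  exact finprod_mul_distrib (hasFiniteMulSupport_levelWeight h.left ..)
    (hasFiniteMulSupport_levelWeight_succ h.right ..)

theorem blockProd_weight_eq {w : List ℕ} (hw : IsStirling w) (A : ℕ → Set Pattern)
    (p : ℕ → Pattern) (x y : ℕ → R) :
    blockProd (fun l => y 0 * weight (sh A) (sh p) (sh x) (sh y) l) w =
      y 0 ^ (tops w).length * ∏ᶠ i, levelWeight A p x y w (i + 1) := by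
  induction hw using IsStirling.induction with
  | nil => simp [blockProd_nil, tops_nil, levelWeight_nil]
  | blockCons b l r h _ ihr =>
    rw [blockProd_blockCons _ h.notMem_left, tops_blockCons h.notMem_left, List.length_cons,
      finprod_levelWeight_succ_blockCons h, ihr]
    ring

theorem weight_eq_countWeight_mul_blockProd {w : List ℕ} (hw : IsStirling w)
    (A : ℕ → Set Pattern) (p : ℕ → Pattern) (x y : ℕ → R) :
    weight A p x y w = countWeight (A 0) (p 0) (x 0) (fun q => q.listCount (tops w)) *
      blockProd (fun l => y 0 * weight (sh A) (sh p) (sh x) (sh y) l) w := by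
  rw [weight, finprod_eq_zero_mul_finprod_succ (hasFiniteMulSupport_levelWeight hw ..),
    blockProd_weight_eq hw, levelWeight, zero_add, hw.bl_one,
    mul_assoc]
  simp only [hw.blockCount_one]

end Weights

theorem g_eq_sum_weight {R : Type*} [CommRing R] [Algebra ℚ R] (A : ℕ → Set Pattern)
    (p : ℕ → Pattern) (n : ℕ) (x y : ℕ → R) :
    g A p n x y = ∑ w ∈ stirlingOn (Finset.Icc 1 n), weight A p x y w := by
  rw [g, stirlingAvoid, Finset.sum_filter]
  refine Finset.sum_congr (stirling_eq_stirlingOn n) fun w hw => ?_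
  have hw' := (mem_stirlingOn.1 hw).1
  split_ifs with havoid
  · exact finprod_congr fun i => by rw [levelWeight, countWeight, if_pos (havoid i)]
  · push Not at havoid
    obtain ⟨i, a, ha, hne⟩ := havoid
    refine (finprod_eq_zero _ i ?_ (hasFiniteMulSupport_levelWeight hw' ..)).symm
    rw [levelWeight, countWeight, if_neg fun h => hne (h a ha), zero_mul]

/-! ### Splitting off the first block -/

theorem mem_iff_of_mem_stirlingOn {S : Finset ℕ} {w : List ℕ} (hw : w ∈ stirlingOn S) {i : ℕ} :
    i ∈ w ↔ i ∈ S := by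
  rw [← (mem_stirlingOn.1 hw).2, List.mem_toFinset]

theorem nil_mem_stirlingOn_iff {S : Finset ℕ} : [] ∈ stirlingOn S ↔ S = ∅ := by
  rw [mem_stirlingOn, List.toFinset_nil, eq_comm]
  exact and_iff_right .nil

section

variable {S U : Finset ℕ} {b : ℕ} {l r : List ℕ}

theorem blockCons_mem_stirlingOn (hU : U ⊆ S) (hb : IsLeast (U : Set ℕ) b)
    (hl : l ∈ stirlingOn (U.erase b)) (hr : r ∈ stirlingOn (S \ U)) :
    blockCons b l r ∈ stirlingOn S := by
  have mem_l {i : ℕ} : i ∈ l ↔ i ≠ b ∧ i ∈ U := by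
    rw [mem_iff_of_mem_stirlingOn hl, Finset.mem_erase]
  have mem_r {i : ℕ} : i ∈ r ↔ i ∈ S ∧ i ∉ U := by
    rw [mem_iff_of_mem_stirlingOn hr, Finset.mem_sdiff]
  refine mem_stirlingOn.2 ⟨isStirling_blockCons (mem_stirlingOn.1 hl).1 (mem_stirlingOn.1 hr).1
    (fun h => (mem_r.1 h).2 hb.1) (fun i hil hir => (mem_r.1 hir).2 (mem_l.1 hil).2)
    (fun i hi => (hb.2 (mem_l.1 hi).2).lt_of_ne (mem_l.1 hi).1.symm), ?_⟩
  have hbU : b ∈ U := hb.1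
  ext i
  simp only [List.mem_toFinset, List.mem_cons, List.mem_append, mem_l, mem_r]
  grind

theorem exists_subset_of_blockCons_mem_stirlingOn (h : blockCons b l r ∈ stirlingOn S) :
    ∃ U ⊆ S, IsLeast (U : Set ℕ) b ∧ l ∈ stirlingOn (U.erase b) ∧ r ∈ stirlingOn (S \ U) := by
  obtain ⟨hw, rfl⟩ := mem_stirlingOn.1 h
  have notMem_l := hw.notMem_left
  have notMem_r := hw.notMem_right
  refine ⟨insert b l.toFinset, fun i => by simp; tauto, ?_, mem_stirlingOn.2 ⟨hw.left, ?_⟩,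
    mem_stirlingOn.2 ⟨hw.right, ?_⟩⟩
  · refine ⟨by simp, fun i hi => ?_⟩
    rcases Finset.mem_insert.1 hi with rfl | hi
    · rfl
    · exact (hw.lt_left i (List.mem_toFinset.1 hi)).le
  · rw [Finset.erase_insert (by simpa using notMem_l)]
  · ext i
    have := hw.notMem_left_of_mem_right (i := i)
    have := hw.ne_of_mem_right (i := i)
    simp only [List.mem_toFinset, Finset.mem_sdiff, List.mem_cons, List.mem_append,
      Finset.mem_insert]
    grind

end

open Classical in
theorem sum_stirlingOn {M : Type*} [AddCommMonoid M] (S : Finset ℕ) (Φ : List ℕ → M) :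
    ∑ w ∈ stirlingOn S, Φ w = (if S = ∅ then Φ [] else 0) +
      ∑ U ∈ S.powerset, ∑ b ∈ U with IsLeast (U : Set ℕ) b,
        ∑ l ∈ stirlingOn (U.erase b), ∑ r ∈ stirlingOn (S \ U), Φ (blockCons b l r) := by
  rw [← Finset.sum_filter_add_sum_filter_not _ (· = [])]
  congr 1
  · simp only [Finset.sum_filter, Finset.sum_ite_eq', nil_mem_stirlingOn_iff]
  simp only [Finset.sum_sigma']
  refine (Finset.sum_bij (fun q _ => blockCons q.2.1 q.2.2.1 q.2.2.2) ?_ ?_ ?_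
    fun _ _ => rfl).symm
  · rintro ⟨U, b, l, r⟩ h
    simp only [Finset.mem_sigma, Finset.mem_filter, Finset.mem_powerset] at h ⊢
    obtain ⟨hU, ⟨-, hb⟩, hl, hr⟩ := h
    exact ⟨blockCons_mem_stirlingOn hU hb hl hr, List.cons_ne_nil _ _⟩
  · have split_unique {U : Finset ℕ} {b : ℕ} {l : List ℕ} (hb : b ∈ U)
        (hl : l ∈ stirlingOn (U.erase b)) : U = insert b l.toFinset := by
      rw [(mem_stirlingOn.1 hl).2, Finset.insert_erase hb]
    have notMem_l {U : Finset ℕ} {b : ℕ} {l : List ℕ} (hl : l ∈ stirlingOn (U.erase b)) :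
        b ∉ l := by
      simp [mem_iff_of_mem_stirlingOn hl]
    rintro ⟨U, b, l, r⟩ h ⟨U', b', l', r'⟩ h' heq
    simp only [Finset.mem_sigma, Finset.mem_filter, Finset.mem_powerset] at h h'
    obtain ⟨-, ⟨hb, -⟩, hl, hr⟩ := h
    obtain ⟨-, ⟨hb', -⟩, hl', -⟩ := h'
    obtain ⟨rfl, heq⟩ := List.cons.inj heq
    have notMem_r : b ∉ r := by simp [mem_iff_of_mem_stirlingOn hr, hb]
    obtain ⟨rfl, -, rfl⟩ := (List.append_cons_inj_of_notMem (notMem_l hl) notMem_r).1 heq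
    obtain rfl : U = U' := (split_unique hb hl).trans (split_unique hb' hl').symm
    rfl
  · intro w hw
    obtain ⟨hw, hne⟩ := Finset.mem_filter.1 hw
    obtain ⟨b, w, rfl⟩ := List.exists_cons_of_ne_nil hne
    obtain ⟨l, r, rfl⟩ := (mem_stirlingOn.1 hw).1.exists_eq_blockCons
    obtain ⟨U, hU, hb, hl, hr⟩ := exists_subset_of_blockCons_mem_stirlingOn hw
    refine ⟨⟨U, b, l, r⟩, ?_, rfl⟩
    simp only [Finset.mem_sigma, Finset.mem_filter, Finset.mem_powerset]
    exact ⟨hU, ⟨hb.1, hb⟩, hl, hr⟩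

/-! ### Orderings of a finite set of letters -/

/-- The words that contain each element of `M` exactly once and no other letters. -/
def orderings (M : Finset ℕ) : Finset (List ℕ) :=
  (Multiset.lists M.val).toFinset

theorem mem_orderings_iff_coe {M : Finset ℕ} {s : List ℕ} : s ∈ orderings M ↔ M.val = s := by
  rw [orderings, Multiset.mem_toFinset, Multiset.mem_lists_iff]
  rfl

theorem mem_orderings {M : Finset ℕ} {s : List ℕ} :
    s ∈ orderings M ↔ s.Nodup ∧ s.toFinset = M := by
  rw [mem_orderings_iff_coe, ← Finset.val_inj, List.toFinset_val]
  constructor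
  · intro h
    have hnodup : s.Nodup := Multiset.coe_nodup.1 (h ▸ M.nodup)
    exact ⟨hnodup, by rw [hnodup.dedup, h]⟩
  · rintro ⟨hnodup, h⟩
    rw [← h, hnodup.dedup]

theorem orderings_empty : orderings ∅ = {[]} := by
  ext s
  rw [mem_orderings, List.toFinset_eq_empty_iff, Finset.mem_singleton]
  exact and_iff_right_of_imp (by rintro rfl; exact List.nodup_nil)

theorem perm_toList_of_mem_orderings {M : Finset ℕ} {s : List ℕ} (h : s ∈ orderings M) :
    s.Perm M.toList := by
  rw [← Multiset.coe_eq_coe, Finset.coe_toList, mem_orderings_iff_coe.1 h]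

theorem length_of_mem_orderings {M : Finset ℕ} {s : List ℕ} (h : s ∈ orderings M) :
    s.length = M.card := by
  rw [← Multiset.coe_card, ← mem_orderings_iff_coe.1 h, Finset.card_val]

theorem sum_orderings {N : Type*} [AddCommMonoid N] (M : Finset ℕ) (θ : List ℕ → N) :
    ∑ s ∈ orderings M, θ s =
      ∑ π : Equiv.Perm (Fin M.card), θ (List.ofFn fun i => M.orderEmbOfFin rfl (π i)) := by
  refine (Finset.sum_bij (fun π _ => List.ofFn fun i => M.orderEmbOfFin rfl (π i))
    ?_ ?_ ?_ fun _ _ => rfl).symm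
  · intro π _
    refine mem_orderings.2
      ⟨List.nodup_ofFn.2 ((M.orderEmbOfFin rfl).injective.comp π.injective), ?_⟩
    ext i
    rw [List.mem_toFinset, List.mem_ofFn, ← Finset.mem_coe, ← Finset.range_orderEmbOfFin M rfl]
    exact (π.surjective.exists (p := fun k => M.orderEmbOfFin rfl k = i)).symm
  · intro π _ π' _ h
    ext i
    exact congrArg _ ((M.orderEmbOfFin rfl).injective (congrFun (List.ofFn_injective h) i))
  · intro s hs
    have hlen := length_of_mem_orderings hs
    obtain ⟨hnodup, rfl⟩ := mem_orderings.1 hs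
    let π : Equiv.Perm (Fin s.toFinset.card) := (finCongr hlen.symm).trans <|
      (hnodup.getEquiv s).trans <| (Equiv.subtypeEquivRight fun _ => List.mem_toFinset.symm).trans
        (s.toFinset.orderIsoOfFin rfl).symm.toEquiv
    refine ⟨π, Finset.mem_univ _, List.ext_get (by simp [hlen]) fun n h₁ h₂ => ?_⟩
    simp [π, ← Finset.coe_orderIsoOfFin_apply]

theorem Pattern.ncard_isOccurrence_congr (p : Pattern) {α β : Type*} [LT α] [LT β] {m n : ℕ}
    (h : m = n) {u : Fin m → α} {v : Fin n → β}
    (huv : ∀ j k, u j < u k ↔ v (j.cast h) < v (k.cast h)) :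
    {i : Fin p.len → Fin m | p.IsOccurrence u i}.ncard =
      {i : Fin p.len → Fin n | p.IsOccurrence v i}.ncard := by
  subst h
  simp only [IsOccurrence, OrderIso, huv, Fin.cast_refl, id_eq]

theorem Pattern.listCount_ofFn (p : Pattern) {n : ℕ} (π : Equiv.Perm (Fin n)) (e : Fin n ↪o ℕ) :
    p.listCount (List.ofFn fun i => e (π i)) = p.count π :=
  p.ncard_isOccurrence_congr List.length_ofFn fun j k => by
    simp only [List.get_ofFn, e.lt_iff_lt]

theorem Pattern.listCount_nil (p : Pattern) : p.listCount [] = 0 := by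
  rw [listCount, Set.ncard_eq_zero (Set.toFinite _), Set.eq_empty_iff_forall_notMem]
  exact fun i hi => (i ⟨0, hi.1⟩).elim0

section

variable {R : Type*} [CommRing R] (A : Set Pattern) (p : Pattern) (z : R)

theorem sum_countWeight_orderings (M : Finset ℕ) :
    ∑ s ∈ orderings M, countWeight A p z (fun q => q.listCount s) = f A p M.card z := by
  simp only [sum_orderings, Pattern.listCount_ofFn]
  rw [f, permAvoid, Finset.sum_filter]
  rfl

theorem f_zero : f A p 0 z = 1 := by
  rw [← Finset.card_empty (α := ℕ), ← sum_countWeight_orderings, orderings_empty,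
    Finset.sum_singleton]
  simp only [Pattern.listCount_nil]
  exact countWeight_zero ..

end

/-! ### Exponential coefficients of power series -/

/-- The coefficient of `t ^ n / n!` in `H`. -/
def egfCoeff {R : Type*} [Semiring R] (H : R⟦X⟧) (n : ℕ) : R :=
  n.factorial * coeff n H

theorem egfCoeff_one {R : Type*} [Semiring R] (n : ℕ) :
    egfCoeff (1 : R⟦X⟧) n = if n = 0 then 1 else 0 := by
  rw [egfCoeff, coeff_one]
  split_ifs with h <;> simp [h]

theorem egfCoeff_mul_card {R : Type*} [CommSemiring R] (H K : R⟦X⟧) (S : Finset ℕ) :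
    egfCoeff (H * K) S.card =
      ∑ U ∈ S.powerset, egfCoeff H U.card * egfCoeff K (S \ U).card := by
  have hcard : ∀ U ∈ S.powerset, egfCoeff H U.card * egfCoeff K (S \ U).card =
      egfCoeff H U.card * egfCoeff K (S.card - U.card) := fun U hU => by
    rw [Finset.card_sdiff_of_subset (Finset.mem_powerset.1 hU)]
  rw [Finset.sum_congr rfl hcard,
    Finset.sum_powerset_apply_card fun k => egfCoeff H k * egfCoeff K (S.card - k), egfCoeff,
    coeff_mul, Finset.Nat.sum_antidiagonal_eq_sum_range_succ fun i j => coeff i H * coeff j K,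
    Finset.mul_sum]
  refine Finset.sum_congr rfl fun k hk => ?_
  rw [egfCoeff, egfCoeff, nsmul_eq_mul,
    ← Nat.choose_mul_factorial_mul_factorial (Nat.lt_succ_iff.1 (Finset.mem_range.1 hk))]
  push_cast
  ring

theorem egfCoeff_subst {R : Type*} [CommRing R] {H : R⟦X⟧} (h₀ : constantCoeff H = 0) (K : R⟦X⟧)
    (n : ℕ) :
    egfCoeff (K.subst H) n = ∑ m ∈ Finset.range (n + 1), coeff m K * egfCoeff (H ^ m) n := by
  rw [egfCoeff, coeff_subst' (HasSubst.of_constantCoeff_zero' h₀),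
    finsum_eq_sum_of_support_subset (s := Finset.range (n + 1)), Finset.mul_sum]
  · exact Finset.sum_congr rfl fun m _ => mul_left_comm ..
  · intro m hm
    by_contra hn
    have hnm : n < m := by simpa using hn
    have hcoeff : coeff n (H ^ m) = 0 := coeff_of_lt_order _ <|
      (Nat.cast_lt.2 hnm).trans_le (le_order_pow_of_constantCoeff_eq_zero m h₀)
    exact hm (by simp only [hcoeff, smul_zero])

theorem egfCoeff_C_mul {R : Type*} [CommSemiring R] (a : R) (H : R⟦X⟧) (n : ℕ) :
    egfCoeff (C a * H) n = a * egfCoeff H n := by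
  rw [egfCoeff, egfCoeff, coeff_C_mul, mul_left_comm]

section

variable {R : Type*} [CommRing R] [Algebra ℚ R]

theorem natCast_mul_algebraMap_one_div {n : ℕ} (hn : n ≠ 0) :
    (n : R) * algebraMap ℚ R (1 / n) = 1 := by
  rw [← map_natCast (algebraMap ℚ R), ← map_mul, mul_one_div_cancel (Nat.cast_ne_zero.2 hn),
    map_one]

theorem ext_egfCoeff {H K : R⟦X⟧} (h : ∀ n, egfCoeff H n = egfCoeff K n) : H = K := by
  ext n
  exact (IsUnit.of_mul_eq_one _
    (natCast_mul_algebraMap_one_div (R := R) n.factorial_ne_zero)).mul_left_cancel (h n)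

theorem egfCoeff_egf {c : ℕ → R} (h₀ : c 0 = 1) (n : ℕ) : egfCoeff (egf c) n = c n := by
  rw [egfCoeff, egf, coeff_mk]
  split_ifs with hn
  · rw [hn, h₀, Nat.factorial_zero, Nat.cast_one, mul_one]
  · rw [← mul_assoc, natCast_mul_algebraMap_one_div n.factorial_ne_zero, one_mul]

theorem constantCoeff_integral (H : R⟦X⟧) : constantCoeff (integral H) = 0 := by
  rw [← coeff_zero_eq_constantCoeff_apply, integral, coeff_mk, if_pos rfl]

theorem egfCoeff_integral_succ (H : R⟦X⟧) (n : ℕ) :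
    egfCoeff (integral H) (n + 1) = egfCoeff H n := by
  rw [egfCoeff, egfCoeff, integral, coeff_mk, if_neg n.succ_ne_zero, Nat.add_sub_cancel,
    Nat.factorial_succ, Nat.cast_mul]
  linear_combination
    n.factorial * coeff n H * natCast_mul_algebraMap_one_div (R := R) n.succ_ne_zero

end

/-! ### Summation over Stirling words by their level `1` blocks -/

section

variable {R : Type*} [CommSemiring R] (ω : List ℕ → R)

open Classical in
/-- The sum of `ω l` over the Stirling words `b l b` with set of letters `U`. -/
def blockSum (b : ℕ) (U : Finset ℕ) : R :=
  if IsLeast (U : Set ℕ) b then ∑ l ∈ stirlingOn (U.erase b), ω l else 0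

/-- The sum over the Stirling words `w` with set of letters `S` of the product of `ω l` over the
level `1` blocks `b l b` of `w`, times a weight `θ` on the letters of these blocks. -/
def wordSum (θ : List ℕ → R) (S : Finset ℕ) : R :=
  ∑ w ∈ stirlingOn S, θ (tops w) * blockProd ω w

/-- The part of `wordSum` that comes from the words whose level `1` blocks have the letters `s`. -/
def topSum (s : List ℕ) (S : Finset ℕ) : R :=
  wordSum ω (Pi.single s 1) S

theorem wordSum_zero (S : Finset ℕ) : wordSum ω 0 S = 0 := by
  simp [wordSum]

theorem wordSum_eq (θ : List ℕ → R) (S : Finset ℕ) :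
    wordSum ω θ S = (if S = ∅ then θ [] else 0) +
      ∑ U ∈ S.powerset, ∑ b ∈ U, blockSum ω b U * wordSum ω (fun s => θ (b :: s)) (S \ U) := by
  classical
  rw [wordSum, sum_stirlingOn, tops_nil, blockProd_nil, mul_one]
  congr 1
  refine Finset.sum_congr rfl fun U _ => ?_
  rw [Finset.sum_filter]
  refine Finset.sum_congr rfl fun b _ => ?_
  rw [blockSum, ite_mul, zero_mul]
  refine if_congr Iff.rfl ?_ rfl
  rw [wordSum, Finset.sum_mul_sum]
  refine Finset.sum_congr rfl fun l hl => Finset.sum_congr rfl fun r _ => ?_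
  have hbl : b ∉ l := by simp [mem_iff_of_mem_stirlingOn hl]
  rw [tops_blockCons hbl, blockProd_blockCons ω hbl, mul_left_comm]

theorem topSum_cons (b : ℕ) (s : List ℕ) (S : Finset ℕ) :
    topSum ω (b :: s) S = ∑ U ∈ S.powerset, blockSum ω b U * topSum ω s (S \ U) := by
  have hsingle (a : ℕ) : (fun t => (Pi.single (b :: s) 1 : List ℕ → R) (a :: t)) =
      if a = b then Pi.single s 1 else 0 := by
    ext t
    split_ifs with h <;> simp [Pi.single_apply, h]
  rw [topSum, wordSum_eq, Pi.single_eq_of_ne (List.cons_ne_nil b s).symm, ite_self, zero_add]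
  refine Finset.sum_congr rfl fun U _ => ?_
  by_cases hb : b ∈ U
  · rw [Finset.sum_eq_single_of_mem b hb fun a _ hab => by
      rw [hsingle, if_neg hab, wordSum_zero, mul_zero], hsingle, if_pos rfl, topSum]
  · have hblock : blockSum ω b U = 0 := if_neg fun h => hb h.1
    rw [hblock, zero_mul]
    refine Finset.sum_eq_zero fun a ha => ?_
    rw [hsingle, if_neg (ne_of_mem_of_not_mem ha hb), wordSum_zero, mul_zero]

theorem topSum_swap (a b : ℕ) (s : List ℕ) (S : Finset ℕ) :
    topSum ω (a :: b :: s) S = topSum ω (b :: a :: s) S := by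
  simp only [topSum_cons, Finset.mul_sum]
  rw [Finset.sum_comm' (t' := S.powerset) (s' := fun U => (S \ U).powerset)]
  · refine Finset.sum_congr rfl fun T _ => Finset.sum_congr rfl fun U _ => ?_
    rw [sdiff_right_comm, mul_left_comm]
  · intro T U
    simp only [Finset.mem_powerset, Finset.subset_sdiff, disjoint_comm (a := T)]
    tauto

theorem topSum_perm {s t : List ℕ} (h : s.Perm t) (S : Finset ℕ) :
    topSum ω s S = topSum ω t S := by
  induction h generalizing S with
  | nil => rfl
  | cons a _ ih => simp only [topSum_cons, ih]
  | swap a b s => exact topSum_swap ω b a s S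
  | trans _ _ ih₁ ih₂ => exact (ih₁ S).trans (ih₂ S)

theorem wordSum_eq_sum_topSum (θ : List ℕ → R) (S : Finset ℕ) :
    wordSum ω θ S = ∑ M ∈ S.powerset, ∑ s ∈ orderings M, θ s * topSum ω s S := by
  have tops_mem : ∀ w ∈ stirlingOn S, (⟨(tops w).toFinset, tops w⟩ : Σ _ : Finset ℕ, List ℕ) ∈
      S.powerset.sigma orderings := fun w hw => by
    have hst := (mem_stirlingOn.1 hw).1
    refine Finset.mem_sigma.2 ⟨Finset.mem_powerset.2 fun i hi => ?_,
      mem_orderings.2 ⟨hst.nodup_tops, rfl⟩⟩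
    exact (mem_iff_of_mem_stirlingOn hw).1 (hst.mem_of_mem_tops (List.mem_toFinset.1 hi))
  rw [wordSum, ← Finset.sum_fiberwise_of_maps_to tops_mem, Finset.sum_sigma]
  refine Finset.sum_congr rfl fun M _ => Finset.sum_congr rfl fun s hs => ?_
  rw [topSum, wordSum, Finset.mul_sum, Finset.sum_filter]
  refine Finset.sum_congr rfl fun w _ => ?_
  have hiff : (⟨(tops w).toFinset, tops w⟩ : Σ _ : Finset ℕ, List ℕ) = ⟨M, s⟩ ↔ tops w = s := by
    simp only [Sigma.mk.injEq, heq_eq_eq, and_iff_right_iff_imp]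
    rintro rfl
    exact (mem_orderings.1 hs).2
  simp only [hiff, Pi.single_apply]
  split_ifs with h
  · rw [h, one_mul]
  · rw [zero_mul, mul_zero]

theorem wordSum_eq_sum_range {θ : List ℕ → R} {c : ℕ → R}
    (hθ : ∀ M, ∑ s ∈ orderings M, θ s = c M.card) (S : Finset ℕ) :
    wordSum ω θ S = ∑ m ∈ Finset.range (S.card + 1),
      c m * ∑ M ∈ S.powersetCard m, topSum ω M.toList S := by
  rw [wordSum_eq_sum_topSum, Finset.sum_powerset]
  refine Finset.sum_congr rfl fun m _ => ?_
  rw [Finset.mul_sum]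
  refine Finset.sum_congr rfl fun M hM => ?_
  rw [← (Finset.mem_powersetCard.1 hM).2, ← hθ, Finset.sum_mul]
  refine Finset.sum_congr rfl fun s hs => ?_
  rw [topSum_perm ω (perm_toList_of_mem_orderings hs)]

theorem card_orderings (M : Finset ℕ) : (orderings M).card = M.card.factorial := by
  rw [Finset.card_eq_sum_ones, sum_orderings, ← Finset.card_eq_sum_ones, Finset.card_univ,
    Fintype.card_perm, Fintype.card_fin]

theorem wordSum_length_eq_factorial_mul {m : ℕ} {S : Finset ℕ} (hm : m ≤ S.card) :
    wordSum ω (fun s => if s.length = m then 1 else 0) S =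
      m.factorial * ∑ M ∈ S.powersetCard m, topSum ω M.toList S := by
  have hθ (M : Finset ℕ) : ∑ s ∈ orderings M, (if s.length = m then 1 else 0 : R) =
      if M.card = m then (m.factorial : R) else 0 := by
    rw [Finset.sum_congr rfl fun s hs => by rw [length_of_mem_orderings hs]]
    split_ifs with h
    · rw [Finset.sum_const, card_orderings, h, nsmul_one]
    · exact Finset.sum_const_zero
  rw [wordSum_eq_sum_range ω (c := fun k => if k = m then (m.factorial : R) else 0) hθ,
    Finset.sum_eq_single_of_mem m (Finset.mem_range.2 (by omega)) fun k _ hk => by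
      rw [if_neg hk, zero_mul], if_pos rfl]

end

section

variable {R : Type*} [CommRing R] {ω : List ℕ → R} {H : R⟦X⟧} (h₀ : constantCoeff H = 0)
include h₀

theorem sum_blockSum {S : Finset ℕ}
    (hω : ∀ T ⊂ S, ∑ l ∈ stirlingOn T, ω l = egfCoeff H (T.card + 1)) :
    ∑ b ∈ S, blockSum ω b S = egfCoeff H S.card := by
  rcases S.eq_empty_or_nonempty with rfl | hS
  · rw [Finset.sum_empty, Finset.card_empty, egfCoeff, coeff_zero_eq_constantCoeff_apply, h₀,
      mul_zero]
  have hleast := S.isLeast_min' hS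
  have hblock (b : ℕ) (hb : b ≠ S.min' hS) : blockSum ω b S = 0 :=
    if_neg fun h => hb (h.unique hleast)
  rw [Finset.sum_eq_single_of_mem _ hleast.1 fun b _ => hblock b, blockSum,
    if_pos hleast, hω _ (Finset.erase_ssubset hleast.1), Finset.card_erase_add_one hleast.1]

theorem wordSum_length_eq_egfCoeff_pow {S : Finset ℕ}
    (hω : ∀ T ⊂ S, ∑ l ∈ stirlingOn T, ω l = egfCoeff H (T.card + 1)) (m : ℕ) :
    wordSum ω (fun s => if s.length = m then 1 else 0) S = egfCoeff (H ^ m) S.card := by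
  induction m generalizing S with
  | zero =>
    have hzero (S : Finset ℕ) : wordSum ω (fun _ => 0) S = 0 := wordSum_zero ω S
    rw [wordSum_eq]
    simp [egfCoeff_one, hzero]
  | succ m ih =>
    rw [wordSum_eq, pow_succ', egfCoeff_mul_card]
    simp only [List.length_nil, (Nat.succ_ne_zero m).symm, if_false, ite_self, zero_add,
      List.length_cons, Nat.add_right_cancel_iff]
    refine Finset.sum_congr rfl fun U hU => ?_
    have hUS := Finset.mem_powerset.1 hU
    rw [← Finset.sum_mul, sum_blockSum h₀ fun T hT => hω T (hT.trans_subset hUS),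
      ih fun T hT => hω T (hT.trans_subset Finset.sdiff_subset)]

/-- The compositional formula for exponential generating functions: choosing a Stirling word amounts
to choosing an ordered sequence of blocks. -/
theorem wordSum_eq_egfCoeff_subst {θ : List ℕ → R} {K : R⟦X⟧} {S : Finset ℕ}
    (hθ : ∀ M, ∑ s ∈ orderings M, θ s = egfCoeff K M.card)
    (hω : ∀ T ⊂ S, ∑ l ∈ stirlingOn T, ω l = egfCoeff H (T.card + 1)) :
    wordSum ω θ S = egfCoeff (K.subst H) S.card := by
  rw [wordSum_eq_sum_range ω hθ, egfCoeff_subst h₀]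
  refine Finset.sum_congr rfl fun m hm => ?_
  have hmS : m ≤ S.card := Nat.lt_succ_iff.1 (Finset.mem_range.1 hm)
  rw [← wordSum_length_eq_egfCoeff_pow h₀ hω, wordSum_length_eq_factorial_mul ω hmS, egfCoeff]
  ring

end

/-! ### The functional equation -/

section

variable {R : Type*} [CommRing R] [Algebra ℚ R]

theorem g_zero (A : ℕ → Set Pattern) (p : ℕ → Pattern) (x y : ℕ → R) : g A p 0 x y = 1 := by
  rw [g_eq_sum_weight, sum_stirlingOn]
  simp [weight_nil]

theorem egfCoeff_F (A : Set Pattern) (p : Pattern) (z : R) (n : ℕ) :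
    egfCoeff (F A p z) n = f A p n z :=
  egfCoeff_egf (f_zero A p z) n

theorem egfCoeff_G (A : ℕ → Set Pattern) (p : ℕ → Pattern) (x y : ℕ → R) (n : ℕ) :
    egfCoeff (G A p x y) n = g A p n x y :=
  egfCoeff_egf (g_zero A p x y) n

theorem sum_weight_eq_egfCoeff_subst (A : ℕ → Set Pattern) (p : ℕ → Pattern) (x y : ℕ → R)
    (S : Finset ℕ) :
    ∑ w ∈ stirlingOn S, weight A p x y w =
      egfCoeff ((F (A 0) (p 0) (x 0)).subst
        (C (y 0) * integral (G (sh A) (sh p) (sh x) (sh y)) : R⟦X⟧)) S.card := by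
  induction hn : S.card using Nat.strong_induction_on generalizing A p x y S with
  | _ n ih =>
  subst hn
  have sum_inner : ∀ T ⊂ S, ∑ l ∈ stirlingOn T, y 0 * weight (sh A) (sh p) (sh x) (sh y) l =
      egfCoeff (C (y 0) * integral (G (sh A) (sh p) (sh x) (sh y))) (T.card + 1) := by
    intro T hT
    have hlt := Finset.card_lt_card hT
    rw [egfCoeff_C_mul, egfCoeff_integral_succ, egfCoeff_G, g_eq_sum_weight, ← Finset.mul_sum,
      ih _ hlt _ _ _ _ T rfl, ih _ hlt _ _ _ _ (Finset.Icc 1 T.card) (by simp)]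
  have h₀ : constantCoeff (C (y 0) * integral (G (sh A) (sh p) (sh x) (sh y))) = 0 := by
    rw [map_mul, constantCoeff_integral, mul_zero]
  rw [← wordSum_eq_egfCoeff_subst h₀ (θ := fun s =>
    countWeight (A 0) (p 0) (x 0) fun q => q.listCount s)
    (fun M => by rw [sum_countWeight_orderings, egfCoeff_F]) sum_inner, wordSum]
  exact Finset.sum_congr rfl fun w hw =>
    weight_eq_countWeight_mul_blockProd (mem_stirlingOn.1 hw).1 A p x y

end

end BlockPattern

end

theorem theorem1 {R : Type*} [CommRing R] [Algebra ℚ R]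
    (A : ℕ → Set BlockPattern.Pattern) (p : ℕ → BlockPattern.Pattern) (x y : ℕ → R) :
    BlockPattern.G A p x y =
      (BlockPattern.F (A 0) (p 0) (x 0)).subst
        (PowerSeries.C (y 0) *
          BlockPattern.integral
            (BlockPattern.G (BlockPattern.sh A) (BlockPattern.sh p)
              (BlockPattern.sh x) (BlockPattern.sh y)) : PowerSeries R) := by
  refine BlockPattern.ext_egfCoeff fun n => ?_
  have hcard : (Finset.Icc 1 n).card = n := by rw [Nat.card_Icc, Nat.add_sub_cancel]
  rw [BlockPattern.egfCoeff_G, BlockPattern.g_eq_sum_weight,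
    BlockPattern.sum_weight_eq_egfCoeff_subst, hcard]
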